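/- Let $W$ be a finite Coxeter group with set of simple reflections $S$, length function $\ell$ and identity $e$. Let $T=\{xsx^{-1} : s\in S,\ x\in W\}$ be the set of reflections, and for $w\in W$ let the reflection length $\ell_T(w)$ be the smallest $n\ge 0$ such that $w$ is a product of $n$ elements of $T$. Let $\le$ denote the (right) weak order on $W$, i.e. the reflexive and transitive closure of the relations $x<xs$ for $x\in W$, $s\in S$ with $\ell(x)<\ell(xs)$. Let $\mathbf{w}=(s_1,\dots,s_m)$ be a finite, not necessarily reduced, word in $S$, and let $w=s_1s_2\cdots s_m$. An $e$-subword of $\mathbf{w}$ is a sequence $\mathbf{u}=(u_1,\dots,u_m)$ with $u_i\in\{s_i,e\}$ for all $i$ and $u_1u_2\cdots u_m=e$. Put $U_0=e$ and $U_i=u_1\cdots u_i$; the subword $\mathbf{u}$ is called distinguished if $U_i\le U_{i-1}s_i$ for all $1\le i\le m$. Let $\mathcal{D}_{e,\mathbf{w}}$ be the set of distinguished $e$-subwords of $\mathbf{w}$, and let $\mathrm{e}_{\mathbf{u}}=|\{i : u_i=e\}|$ be the number of letters skipped by $\mathbf{u}$. Then $\mathcal{D}_{e,\mathbf{w}}$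 is non-empty and $$\ell_T(w)=\min_{\mathbf{u}\in\mathcal{D}_{e,\mathbf{w}}}\mathrm{e}_{\mathbf{u}}.$$ -/

import Mathlib

namespace CoxeterSystem

variable {B W : Type*} [Group W] {M : CoxeterMatrix B} (cs : CoxeterSystem M W)

/-- The (right) weak order on `W`: the reflexive and transitive closure of the relations
`x < x s`, for `s` a simple reflection with `ℓ x < ℓ (x s)`. -/
def WeakLE : W → W → Prop :=
  Relation.ReflTransGen fun x y =>
    ∃ i : B, y = x * cs.simple i ∧ cs.length x < cs.length (x * cs.simple i)

/-- `w` is a product of `n` reflections. -/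
def IsProdOfReflections (w : W) (n : ℕ) : Prop :=
  ∃ l : List W, (∀ t ∈ l, cs.IsReflection t) ∧ l.length = n ∧ l.prod = w

theorem exists_isProdOfReflections (w : W) : ∃ n, cs.IsProdOfReflections w n := by
  obtain ⟨ω, rfl⟩ := cs.wordProd_surjective w
  refine ⟨_, ω.map cs.simple, ?_, rfl, rfl⟩
  intro t ht
  obtain ⟨i, -, rfl⟩ := List.mem_map.1 ht
  exact cs.isReflection_simple i

open Classical in
/-- The reflection length `ℓ_T(w)`: the smallest `n` such that `w` is a product of
`n` reflections. -/
noncomputable def reflectionLength (w : W) : ℕ :=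
  Nat.find (cs.exists_isProdOfReflections w)

/-- `u = (u₁, …, uₘ)` is a subword of the word `ω = (s₁, …, sₘ)`: it has the same length, and
each `uⱼ` is either `sⱼ` or the identity. -/
def IsSubword (ω : List B) (u : List W) : Prop :=
  List.Forall₂ (fun i x => x = cs.simple i ∨ x = 1) ω u

/-- The subword `u` of `ω` is distinguished: with `Uⱼ = u₁ ⋯ uⱼ` (and `U₀ = 1`), one has
`Uⱼ ≤ Uⱼ₋₁ sⱼ` in the weak order for all `j`. (Here `j = k + 1`.) -/
def IsDistinguished (ω : List B) (u : List W) : Prop :=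
  ∀ (k : ℕ) (hk : k < ω.length),
    cs.WeakLE (u.take (k + 1)).prod ((u.take k).prod * cs.simple ω[k])

/-- The set of distinguished `v`-subwords of `ω`. -/
def distinguishedSubwords (v : W) (ω : List B) : Set (List W) :=
  {u | cs.IsSubword ω u ∧ u.prod = v ∧ cs.IsDistinguished ω u}

end CoxeterSystem

open Classical in
/-- The number of skipped letters of a subword `u`: the number of indices `j` with `uⱼ = 1`. -/
noncomputable def numSkipped {W : Type*} [Group W] (u : List W) : ℕ :=
  u.count 1

/-!
The argument does not use finiteness of `W`, and works with reflections and lengths only.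

Deleting a letter from a word multiplies its product by a reflection. Hence an `e`-subword of `ω`
skipping `n` letters writes `w` as a product of `n` reflections
(`isProdOfReflections_of_isSubword`), which gives the lower bound.

For the upper bound, the tool is the strong exchange property, in a form valid for every subword
(`exists_skip`): if `t` is a reflection with `ℓ(xt) < ℓ(x)` and `x` is the product of a subword `u`,
then skipping one more letter of `u` gives a subword with product `xt`. Following the standard
proof, it comes from the reflection cocycle `cs.reflectionParity`, the parity of the number of
times `t` occurs in the right inversion sequence of a word for `x`. Two facts are deduced.

* If `ℓ_T(w) = k + 1`, some reflection `t` has `ℓ(wt) < ℓ(w)` and `ℓ_T(wt) = k`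
  (`exists_isReflection_length_mul_lt`). Iterating this and skipping one letter of `ω` at each
  step yields an `e`-subword with exactly `ℓ_T(w)` skipped letters.
* Every subword can be made distinguished without changing its product or the number of skipped
  letters (`exists_isDistinguished`). If the letter `s` is skipped after a prefix with product `U`
  although `ℓ(Us) < ℓ(U)`, then by exchange one may skip a letter of the prefix instead, which
  changes its product to `Us`, and then use the letter `s`.
-/

namespace CoxeterSystem

variable {B W : Type*} [Group W] {M : CoxeterMatrix B} (cs : CoxeterSystem M W)

/-! ### The reflection cocycle -/

open Classical in
/-- The map `(t, ε) ↦ (sᵢ t sᵢ, ε + [t = sᵢ])` on `W × ZMod 2`. It is defined for all `t : W`,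
although only reflections `t` matter. -/
noncomputable def signedConj (i : B) : Function.End (W × ZMod 2) :=
  fun p => (cs.simple i * p.1 * cs.simple i, p.2 + if p.1 = cs.simple i then 1 else 0)

open Classical in
/-- In the dihedral group generated by `sᵢ` and `sⱼ`, the reflections met along the word
`(sᵢ sⱼ)ⁿ` are `sⱼ (sᵢ sⱼ)ᵏ` for `k < 2n`. -/
theorem signedConj_mul_pow_apply (i j : B) (n : ℕ) (p : W × ZMod 2) :
    ((cs.signedConj i * cs.signedConj j) ^ n) p =
      ((cs.simple i * cs.simple j) ^ n * p.1 * ((cs.simple i * cs.simple j) ^ n)⁻¹,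
        p.2 + ∑ k ∈ Finset.range (2 * n),
          if p.1 = cs.simple j * (cs.simple i * cs.simple j) ^ k then 1 else 0) := by
  induction n generalizing p with
  | zero => simp [Function.End.one_def]
  | succ n ih =>
    rw [pow_succ]
    change ((cs.signedConj i * cs.signedConj j) ^ n) (cs.signedConj i (cs.signedConj j p)) = _
    rw [ih]
    obtain ⟨t, ε⟩ := p
    have hconj : ∀ k, (cs.simple i * (cs.simple j * t * cs.simple j) * cs.simple i =
        cs.simple j * (cs.simple i * cs.simple j) ^ k) ↔
        t = cs.simple j * (cs.simple i * cs.simple j) ^ (k + 2) := by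
      intro k
      have e : cs.simple j * (cs.simple i * cs.simple j) ^ (k + 2) = cs.simple j * cs.simple i *
          (cs.simple j * (cs.simple i * cs.simple j) ^ k) * cs.simple i * cs.simple j := by
        rw [pow_succ, pow_succ']
        simp only [mul_assoc]
      rw [e]
      constructor
      · intro h
        rw [← h]
        simp [mul_assoc]
      · rintro rfl
        simp [mul_assoc]
    have hfirst : (cs.simple j * t * cs.simple j = cs.simple i) ↔
        t = cs.simple j * (cs.simple i * cs.simple j) ^ 1 := by
      constructor
      · intro h
        rw [← h]; simp [mul_assoc]
      · rintro rfl
        simp [mul_assoc]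
    ext
    · simp [signedConj, pow_succ, mul_assoc]
    · simp only [signedConj, hconj, hfirst]
      rw [show 2 * (n + 1) = 2 * n + 1 + 1 by ring, Finset.sum_range_succ', Finset.sum_range_succ']
      simp only [pow_zero, mul_one]
      ring

open Classical in
theorem isLiftable_signedConj : M.IsLiftable cs.signedConj := by
  intro i j
  have hperiod : ∀ k, (cs.simple i * cs.simple j) ^ (M i j + k) =
      (cs.simple i * cs.simple j) ^ k := by
    intro k
    rw [pow_add, simple_mul_simple_pow, one_mul]
  -- The summands `k` and `M i j + k` agree, so each reflection is met an even number of times.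
  have hsum : ∀ t : W, ∑ k ∈ Finset.range (2 * M i j),
      (if t = cs.simple j * (cs.simple i * cs.simple j) ^ k then 1 else 0 : ZMod 2) = 0 := by
    intro t
    rw [two_mul, Finset.sum_range_add]
    simp_rw [hperiod]
    exact CharTwo.add_self_eq_zero _
  funext p
  refine (cs.signedConj_mul_pow_apply i j (M i j) p).trans ?_
  rw [hsum, simple_mul_simple_pow, one_mul, inv_one, mul_one, add_zero]
  rfl

/-- The action of `W` on `W × ZMod 2` in which `sᵢ` acts by `signedConj i`. -/
noncomputable def signedConjHom : W →* Function.End (W × ZMod 2) :=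
  cs.lift ⟨cs.signedConj, cs.isLiftable_signedConj⟩

/-- For a reflection `t`, the parity of the number of occurrences of `t` in the right inversion
sequence of any word for `w`. -/
noncomputable def reflectionParity (w t : W) : ZMod 2 :=
  (cs.signedConjHom w (t, 0)).2

theorem signedConjHom_apply (w t : W) (ε : ZMod 2) :
    cs.signedConjHom w (t, ε) = (w * t * w⁻¹, ε + cs.reflectionParity w t) := by
  unfold reflectionParity
  induction w using cs.simple_induction_left generalizing t ε with
  | one => simp [Function.End.one_def]
  | mul_simple_left w i ih =>
    have h : ∀ p, cs.signedConjHom (cs.simple i * w) p =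
        cs.signedConj i (cs.signedConjHom w p) := by
      intro p
      rw [map_mul, signedConjHom, lift_apply_simple]
      rfl
    rw [h, h, ih t ε, ih t 0]
    simp [signedConj, mul_assoc, add_assoc]

theorem reflectionParity_mul (v w t : W) :
    cs.reflectionParity (v * w) t =
      cs.reflectionParity w t + cs.reflectionParity v (w * t * w⁻¹) := by
  have h : cs.signedConjHom (v * w) (t, 0) = cs.signedConjHom v (cs.signedConjHom w (t, 0)) := by
    rw [map_mul]; rfl
  rw [reflectionParity, h, signedConjHom_apply, signedConjHom_apply]
  simp

@[simp]
theorem reflectionParity_one (t : W) : cs.reflectionParity 1 t = 0 := by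
  simp [reflectionParity, Function.End.one_def]

open Classical in
theorem reflectionParity_simple (i : B) (t : W) :
    cs.reflectionParity (cs.simple i) t = if t = cs.simple i then 1 else 0 := by
  simp [reflectionParity, signedConjHom, lift_apply_simple, signedConj]

theorem reflectionParity_self {t : W} (ht : cs.IsReflection t) : cs.reflectionParity t t = 1 := by
  obtain ⟨x, i, rfl⟩ := ht
  have h := cs.reflectionParity_mul x x⁻¹ (x * cs.simple i * x⁻¹)
  rw [mul_inv_cancel, reflectionParity_one] at h
  rw [reflectionParity_mul, reflectionParity_mul, reflectionParity_simple]
  have e : x⁻¹ * (x * cs.simple i * x⁻¹) * x⁻¹⁻¹ = cs.simple i := by group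
  rw [e] at h ⊢
  simp only [simple_mul_simple_self, one_mul, inv_simple, if_true]
  linear_combination -h

/-- The induction step behind strong exchange: if `t` occurs an odd number of times for `sᵢ x`, then
it does so for `x`, or multiplying `sᵢ x` by `t` deletes the first letter. -/
theorem reflectionParity_cons (i : B) (x t : W) (h : cs.reflectionParity (cs.simple i * x) t = 1) :
    cs.reflectionParity x t = 1 ∨ cs.simple i * x * t = x := by
  rw [reflectionParity_mul, reflectionParity_simple] at h
  split_ifs at h with hi
  · right
    rw [mul_assoc, mul_inv_eq_iff_eq_mul.1 hi, simple_mul_simple_cancel_left]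
  · left
    simpa using h

/-! ### Strong exchange -/

theorem length_wordProd_mul_lt {ω : List B} {t : W}
    (h : cs.reflectionParity (cs.wordProd ω) t = 1) :
    cs.length (cs.wordProd ω * t) < ω.length := by
  induction ω with
  | nil => simp at h
  | cons i ω ih =>
    rw [wordProd_cons] at h ⊢
    rcases cs.reflectionParity_cons i _ t h with h | h
    · have := cs.length_mul_le (cs.simple i) (cs.wordProd ω * t)
      rw [length_simple, ← mul_assoc] at this
      have := ih h
      simp only [List.length_cons]
      omega
    · rw [h, List.length_cons]
      exact Nat.lt_succ_of_le (cs.length_wordProd_le ω)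

theorem reflectionParity_eq_one_of_length_lt {w t : W} (ht : cs.IsReflection t)
    (h : cs.length (w * t) < cs.length w) : cs.reflectionParity w t = 1 := by
  by_contra hne
  have hzero : cs.reflectionParity w t = 0 := by
    generalize cs.reflectionParity w t = a at hne
    revert hne; revert a; decide
  obtain ⟨ω, hω, hw⟩ := cs.exists_isReduced (w * t)
  have hone : cs.reflectionParity (cs.wordProd ω) t = 1 := by
    rw [← hw, reflectionParity_mul, cs.reflectionParity_self ht, mul_inv_cancel_right, hzero,
      add_zero]
  have := cs.length_wordProd_mul_lt hone
  rw [← hω.eq, ← hw, mul_assoc, ht.mul_self, mul_one] at this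
  omega

/-- Two different inversions of `y` delete two different letters of a reduced word for `y`. Deleting
both letters gives `y t t'` or `y t' t`, depending on which of them comes first. -/
theorem length_mul_mul_lt_or {y t t' : W} (ht : cs.IsReflection t) (ht' : cs.IsReflection t')
    (hne : t ≠ t') (h : cs.length (y * t) < cs.length y) (h' : cs.length (y * t') < cs.length y) :
    cs.length (y * t * t') < cs.length y ∨ cs.length (y * t' * t) < cs.length y := by
  have key : ∀ ω : List B, cs.reflectionParity (cs.wordProd ω) t = 1 →
      cs.reflectionParity (cs.wordProd ω) t' = 1 →
      cs.length (cs.wordProd ω * t * t') < ω.length ∨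
        cs.length (cs.wordProd ω * t' * t) < ω.length := by
    intro ω
    induction ω with
    | nil => intro h; simp at h
    | cons i ω ih =>
      intro h h'
      rw [wordProd_cons] at h h' ⊢
      simp only [List.length_cons]
      rcases cs.reflectionParity_cons i _ t h with h | h
      · rcases cs.reflectionParity_cons i _ t' h' with h' | h'
        · refine (ih h h').imp (fun H => ?_) (fun H => ?_)
          · have := cs.length_mul_le (cs.simple i) (cs.wordProd ω * t * t')
            rw [length_simple] at this
            simp only [mul_assoc] at this H ⊢
            omega
          · have := cs.length_mul_le (cs.simple i) (cs.wordProd ω * t' * t)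
            rw [length_simple] at this
            simp only [mul_assoc] at this H ⊢
            omega
        · right
          rw [h']
          exact (cs.length_wordProd_mul_lt h).trans (Nat.lt_succ_self _)
      · rcases cs.reflectionParity_cons i _ t' h' with h' | h'
        · left
          rw [h]
          exact (cs.length_wordProd_mul_lt h').trans (Nat.lt_succ_self _)
        · exact absurd (mul_left_cancel (h.trans h'.symm)) hne
  obtain ⟨ω, hω, rfl⟩ := cs.exists_isReduced y
  have := key ω (cs.reflectionParity_eq_one_of_length_lt ht h)
    (cs.reflectionParity_eq_one_of_length_lt ht' h')
  rwa [← hω.eq] at this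

/-! ### Reflection length -/

variable {cs} in
theorem IsProdOfReflections.mul {w t : W} {n : ℕ} (hw : cs.IsProdOfReflections w n)
    (ht : cs.IsReflection t) : cs.IsProdOfReflections (w * t) (n + 1) := by
  obtain ⟨l, hl, rfl, rfl⟩ := hw
  refine ⟨l ++ [t], ?_, by simp, by simp⟩
  intro x hx
  rcases List.mem_append.1 hx with hx | hx
  · exact hl x hx
  · rwa [List.mem_singleton.1 hx]

theorem isProdOfReflections_reflectionLength (w : W) :
    cs.IsProdOfReflections w (cs.reflectionLength w) := by
  classical exact Nat.find_spec (cs.exists_isProdOfReflections w)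

variable {cs} in
theorem IsProdOfReflections.reflectionLength_le {w : W} {n : ℕ}
    (hw : cs.IsProdOfReflections w n) : cs.reflectionLength w ≤ n := by
  classical exact Nat.find_min' _ hw

theorem reflectionLength_mul_le (w : W) {t : W} (ht : cs.IsReflection t) :
    cs.reflectionLength (w * t) ≤ cs.reflectionLength w + 1 :=
  ((cs.isProdOfReflections_reflectionLength w).mul ht).reflectionLength_le

theorem reflectionLength_eq_zero {w : W} : cs.reflectionLength w = 0 ↔ w = 1 := by
  constructor
  · intro h
    obtain ⟨l, -, hl, rfl⟩ := cs.isProdOfReflections_reflectionLength w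
    rw [h, List.length_eq_zero_iff] at hl
    simp [hl]
  · rintro rfl
    exact Nat.le_zero.1 (IsProdOfReflections.reflectionLength_le ⟨[], by simp, rfl, rfl⟩)

theorem exists_mul_of_reflectionLength_eq_succ {w : W} {k : ℕ}
    (h : cs.reflectionLength w = k + 1) :
    ∃ y t, cs.IsReflection t ∧ w = y * t ∧ cs.reflectionLength y = k := by
  obtain ⟨l, hl, hk, rfl⟩ := cs.isProdOfReflections_reflectionLength w
  rw [h] at hk
  obtain rfl | ⟨l, t, rfl⟩ := l.eq_nil_or_concat
  · simp at hk
  · simp only [List.concat_eq_append, List.mem_append, List.mem_singleton, List.length_append,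
      List.length_singleton, List.prod_append, List.prod_singleton] at *
    have ht := hl t (Or.inr rfl)
    refine ⟨l.prod, t, ht, rfl, ?_⟩
    have h1 : cs.reflectionLength l.prod ≤ l.length :=
      IsProdOfReflections.reflectionLength_le ⟨l, fun x hx => hl x (Or.inl hx), rfl, rfl⟩
    have h2 := cs.reflectionLength_mul_le l.prod ht
    omega

/-- A reflection that lowers the reflection length of `w ≠ 1` can be chosen to lower its length.
Starting from any factorization `w = y t'` with `ℓ_T(y) = ℓ_T(w) - 1`, as long as `ℓ(y) > ℓ(w)`
one replaces `y` by a shorter element: with `t` an inversion of `y` given by induction on the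
reflection length, one of `y t t'` and `y t' t` is shorter than `y` and can take its place. -/
theorem exists_isReflection_length_mul_lt {w : W} {k : ℕ} (h : cs.reflectionLength w = k + 1) :
    ∃ t, cs.IsReflection t ∧ cs.length (w * t) < cs.length w ∧
      cs.reflectionLength (w * t) = k := by
  induction k generalizing w with
  | zero =>
    obtain ⟨y, t, ht, rfl, hy⟩ := cs.exists_mul_of_reflectionLength_eq_succ h
    rw [reflectionLength_eq_zero] at hy
    subst hy
    refine ⟨t, ht, ?_, ?_⟩
    · rw [one_mul, ht.mul_self, length_one]
      exact ht.odd_length.pos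
    · rw [one_mul, ht.mul_self, reflectionLength_eq_zero]
  | succ k ihk =>
    obtain ⟨y, t', ht', hw, hy⟩ := cs.exists_mul_of_reflectionLength_eq_succ h
    induction hn : cs.length y using Nat.strong_induction_on generalizing y t' with
    | _ n ihn =>
      have hyw : w * t' = y := by rw [hw, mul_assoc, ht'.mul_self, mul_one]
      rcases lt_or_gt_of_ne (ht'.length_mul_left_ne w) with hlt | hgt
      · exact ⟨t', ht', hlt, by rw [hyw, hy]⟩
      rw [hyw] at hgt
      obtain ⟨t, ht, hlt, htk⟩ := ihk hy
      have hne : t ≠ t' := by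
        rintro rfl
        rw [← hw] at htk
        omega
      -- An element `z` with `w = z r` for a reflection `r` has reflection length at least `k + 1`.
      have hle : ∀ z r, cs.IsReflection r → w = z * r → k + 1 ≤ cs.reflectionLength z := by
        rintro z r hr rfl
        have := cs.reflectionLength_mul_le z hr
        omega
      have hty : cs.length (y * t') < cs.length y := hw ▸ hgt
      rcases cs.length_mul_mul_lt_or ht ht' hne hlt hty with hs | hs
      · have hr : cs.IsReflection (t' * t * t') := by simpa [ht'.inv] using ht.conj t'
        have hz : w = y * t * t' * (t' * t * t') := by
          rw [hw, show y * t * t' * (t' * t * t') = y * (t * (t' * t') * t) * t' by group,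
            ht'.mul_self, mul_one, ht.mul_self, mul_one]
        refine ihn _ (hn ▸ hs) (y * t * t') _ hr hz ?_ rfl
        have := cs.reflectionLength_mul_le (y * t) ht'
        have := hle _ _ hr hz
        omega
      · have hr : cs.IsReflection (t * t' * t) := by simpa [ht.inv] using ht'.conj t
        have hz : w = y * t' * t * t := by
          rw [hw, mul_assoc _ t t, ht.mul_self, mul_one]
        refine ihn _ (hn ▸ hs) (y * t' * t) _ ht hz ?_ rfl
        have h1 := cs.reflectionLength_mul_le (y * t) hr
        rw [show y * t * (t * t' * t) = y * (t * t) * t' * t by group, ht.mul_self, mul_one] at h1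
        have := hle _ _ ht hz
        omega

/-! ### Subwords -/

theorem simple_ne_one (i : B) : cs.simple i ≠ 1 := by
  intro h
  simpa [h] using cs.length_simple i

@[simp]
theorem numSkipped_nil : numSkipped ([] : List W) = 0 := by
  simp [numSkipped]

@[simp]
theorem numSkipped_one_cons (u : List W) : numSkipped (1 :: u) = numSkipped u + 1 := by
  simp [numSkipped]

@[simp]
theorem numSkipped_simple_cons (i : B) (u : List W) :
    numSkipped (cs.simple i :: u) = numSkipped u := by
  classical exact List.count_cons_of_ne (cs.simple_ne_one i)

theorem numSkipped_append (u v : List W) : numSkipped (u ++ v) = numSkipped u + numSkipped v := by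
  simp [numSkipped]

theorem isSubword_map_simple (ω : List B) : cs.IsSubword ω (ω.map cs.simple) := by
  induction ω with
  | nil => exact List.Forall₂.nil
  | cons i ω ih => exact List.Forall₂.cons (Or.inl rfl) ih

theorem numSkipped_map_simple (ω : List B) : numSkipped (ω.map cs.simple) = 0 := by
  induction ω with
  | nil => simp
  | cons i ω ih => simpa using ih

/-- Strong exchange for subwords. -/
theorem exists_skip {ω : List B} {u : List W} (hu : cs.IsSubword ω u) {t : W}
    (ht : cs.IsReflection t) (h : cs.length (u.prod * t) < cs.length u.prod) :
    ∃ u', cs.IsSubword ω u' ∧ u'.prod = u.prod * t ∧ numSkipped u' = numSkipped u + 1 := by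
  replace h := cs.reflectionParity_eq_one_of_length_lt ht h
  induction hu with
  | nil => simp at h
  | @cons i x ω u hx hu ih =>
    rcases hx with rfl | rfl
    · rw [List.prod_cons] at h ⊢
      rcases cs.reflectionParity_cons i _ t h with h | h
      · obtain ⟨u', hu', hp, hs⟩ := ih h
        exact ⟨cs.simple i :: u', .cons (Or.inl rfl) hu', by simp [hp, mul_assoc], by simp [hs]⟩
      · exact ⟨1 :: u, .cons (Or.inr rfl) hu, by simp [h], by simp⟩
    · simp only [List.prod_cons, one_mul] at h ⊢
      obtain ⟨u', hu', hp, hs⟩ := ih h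
      exact ⟨1 :: u', .cons (Or.inr rfl) hu', by simp [hp], by simp [hs]⟩

theorem isProdOfReflections_of_isSubword {ω : List B} {u : List W} (hu : cs.IsSubword ω u) :
    cs.IsProdOfReflections (u.prod⁻¹ * cs.wordProd ω) (numSkipped u) := by
  induction hu with
  | nil => exact ⟨[], by simp, by simp, by simp⟩
  | @cons i x ω u hx hu ih =>
    rw [wordProd_cons, List.prod_cons]
    rcases hx with rfl | rfl
    · simpa [mul_assoc] using ih
    · have := ih.mul ((cs.isReflection_simple i).conj (cs.wordProd ω)⁻¹)
      simpa [mul_assoc] using this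

theorem exists_isSubword_prod_eq_one {ω : List B} {u : List W} (hu : cs.IsSubword ω u) :
    ∃ u', cs.IsSubword ω u' ∧ u'.prod = 1 ∧
      numSkipped u' = numSkipped u + cs.reflectionLength u.prod := by
  induction hk : cs.reflectionLength u.prod generalizing u with
  | zero => exact ⟨u, hu, cs.reflectionLength_eq_zero.1 hk, rfl⟩
  | succ k ih =>
    obtain ⟨t, ht, hlt, htk⟩ := cs.exists_isReflection_length_mul_lt hk
    obtain ⟨v, hv, hp, hs⟩ := cs.exists_skip hu ht hlt
    obtain ⟨u', hu', hp', hs'⟩ := ih hv (by rw [hp, htk])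
    exact ⟨u', hu', hp', by omega⟩

/-! ### Distinguished subwords -/

variable {cs} in
theorem IsSubword.append_singleton {ω : List B} {u : List W} (hu : cs.IsSubword ω u) {i : B}
    {x : W} (hx : x = cs.simple i ∨ x = 1) : cs.IsSubword (ω ++ [i]) (u ++ [x]) :=
  List.rel_append hu (.cons hx .nil)

variable {cs} in
theorem IsDistinguished.append_singleton {ω : List B} {u : List W} (hu : cs.IsDistinguished ω u)
    (hlen : ω.length = u.length) {i : B} {x : W}
    (hx : cs.WeakLE (u.prod * x) (u.prod * cs.simple i)) :
    cs.IsDistinguished (ω ++ [i]) (u ++ [x]) := by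
  intro k hk
  rw [List.length_append, List.length_singleton] at hk
  rcases Nat.lt_succ_iff_lt_or_eq.1 hk with hlt | rfl
  · rw [List.take_append_of_le_length (by omega), List.take_append_of_le_length (by omega),
      List.getElem_append_left hlt]
    exact hu k hlt
  · rw [List.take_of_length_le (by simp [hlen]), List.take_append_of_le_length (by omega),
      List.take_of_length_le (by omega)]
    simpa using hx

variable {cs} in
theorem IsSubword.exists_eq_append_singleton {ω : List B} {i : B} {u : List W}
    (hu : cs.IsSubword (ω ++ [i]) u) :
    ∃ v x, cs.IsSubword ω v ∧ (x = cs.simple i ∨ x = 1) ∧ u = v ++ [x] := by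
  induction ω generalizing u with
  | nil =>
    obtain ⟨x, v, hx, hv, rfl⟩ := List.forall₂_cons_left_iff.1 hu
    obtain rfl := List.forall₂_nil_left_iff.1 hv
    exact ⟨[], x, .nil, hx, rfl⟩
  | cons j ω ih =>
    obtain ⟨y, v, hy, hv, rfl⟩ := List.forall₂_cons_left_iff.1 hu
    obtain ⟨v, x, hv', hx, rfl⟩ := ih hv
    exact ⟨y :: v, x, List.Forall₂.cons hy hv', hx, rfl⟩

/-- Skipping a letter `s` after a prefix with product `U` is only allowed if `ℓ(Us) > ℓ(U)`. Otherwise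
exchange provides a prefix with product `Us` and one more skipped letter, after which the letter `s`
is used. -/
theorem exists_isDistinguished {ω : List B} {u : List W} (hu : cs.IsSubword ω u) :
    ∃ u', cs.IsSubword ω u' ∧ u'.prod = u.prod ∧ numSkipped u' = numSkipped u ∧
      cs.IsDistinguished ω u' := by
  induction ω using List.reverseRecOn generalizing u with
  | nil => exact ⟨u, hu, rfl, rfl, fun k hk => absurd hk (by simp)⟩
  | append_singleton ω i ih =>
    obtain ⟨v, x, hv, hx, rfl⟩ := hu.exists_eq_append_singleton
    rcases hx with rfl | rfl
    · obtain ⟨v', hv', hp, hs, hd⟩ := ih hv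
      exact ⟨v' ++ [cs.simple i], hv'.append_singleton (Or.inl rfl), by simp [hp],
        by simp [numSkipped_append, hs], hd.append_singleton hv'.length_eq .refl⟩
    · by_cases hlt : cs.length (v.prod * cs.simple i) < cs.length v.prod
      · obtain ⟨y, hy, hyp, hys⟩ := cs.exists_skip hv (cs.isReflection_simple i) hlt
        obtain ⟨v', hv', hp, hs, hd⟩ := ih hy
        exact ⟨v' ++ [cs.simple i], hv'.append_singleton (Or.inl rfl), by simp [hp, hyp],
          by simp [numSkipped_append, hs, hys], hd.append_singleton hv'.length_eq .refl⟩
      · obtain ⟨v', hv', hp, hs, hd⟩ := ih hv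
        refine ⟨v' ++ [1], hv'.append_singleton (Or.inr rfl), by simp [hp],
          by simp [numSkipped_append, hs], hd.append_singleton hv'.length_eq ?_⟩
        rw [mul_one, hp]
        refine .single ⟨i, rfl, ?_⟩
        have := cs.length_mul_simple_ne v.prod i
        omega

end CoxeterSystem

theorem mainTheorem8 {B W : Type*} [Group W] [Finite W] {M : CoxeterMatrix B}
    (cs : CoxeterSystem M W) (w : W) (ω : List B) (hω : cs.wordProd ω = w) :
    IsLeast (numSkipped '' cs.distinguishedSubwords 1 ω) (cs.reflectionLength w) := by
  subst hω
  constructor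
  · obtain ⟨u, hu, hp, hs⟩ := cs.exists_isSubword_prod_eq_one (cs.isSubword_map_simple ω)
    obtain ⟨u', hu', hp', hs', hd⟩ := cs.exists_isDistinguished hu
    refine ⟨u', ⟨hu', hp'.trans hp, hd⟩, ?_⟩
    rw [hs', hs, cs.numSkipped_map_simple, zero_add]
    rfl
  · rintro _ ⟨u, ⟨hu, hp, -⟩, rfl⟩
    have h := cs.isProdOfReflections_of_isSubword hu
    rw [hp, inv_one, one_mul] at h
    exact h.reflectionLength_le
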